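/- For $\omega\in\{-1,1\}^k$ let $\omega^i$ be $\omega$ with its $i$-th coordinate flipped; the pivotal set of $f:\{-1,1\}^k\to\{-1,1\}$ at $\omega$ is $\mathscr{P}(\omega)=\{i : f(\omega^i)\neq f(\omega)\}$. Let $X_k(t)$ be the continuous time random walk on the hypercube $\{-1,1\}^k$ which crosses each edge incident to its current position at rate $1$, started from the uniform distribution. A sequence $g_n:\{-1,1\}^{k_n}\to\{-1,1\}$ is volatile if the number $C_n$ of times $g_n(X_{k_n}(t))$ changes value for $t\in[0,1]$ tends to $\infty$ in distribution, i.e. $\mathbb{P}[C_n\le M]\to 0$ for every $M$. Below, $\mathbb{P}$ of an event on the hypercube refers to the uniform measure, and monotone means increasing in the coordinatewise order. Let $k_n$ be a sequence of non-negative integers with $k_n\to\infty$ and let $f_n:\{-1,1\}^{k_n}\to\{-1,1\}$ be any sequence of Boolean functions. Then there are a volatile sequence $g_n:\{-1,1\}^{k_n}\to\{-1,1\}$ and a sequence of integers $a_n\to\infty$ such that, with $\mathscr{P}_n$ the pivotal set of $g_n$, $$\lim_{n\to\infty}\mathbb{P}[f_n\neq g_n]=0\qquad\text{and}\qquad \lim_{n\to\infty}\mathbb{P}\big[|\mathscr{P}_n|>a_n\big]=1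 .$$ Moreover, if all $f_n$ are monotone, then such $g_n$ can be chosen with all $g_n$ monotone. -/

import Mathlib

open Filter Topology MeasureTheory ProbabilityTheory
open scoped NNReal ENNReal

/-- The discrete cube `{-1,1}^k`; the two-element set `{-1,1}` is the unit group `ℤˣ`, ordered by
`-1 < 1`, and the cube carries the coordinatewise order. -/
abbrev Cube (k : ℕ) : Type := Fin k → ℤˣ

/-- Boolean functions `{-1,1}^k → {-1,1}`. -/
abbrev BooleanFunction (k : ℕ) : Type := Cube k → ℤˣ

/-- Every subset of `{-1,1}` is measurable. -/
instance : DiscreteMeasurableSpace ℤˣ :=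
  ⟨fun s => ⟨Units.val '' s, trivial, Set.preimage_image_eq s Units.val_injective⟩⟩

/-- The uniform probability measure on the cube. -/
noncomputable def cubeMeasure (k : ℕ) : Measure (Cube k) := uniformOn Set.univ

/-- The configuration `ω` with its `i`-th coordinate flipped. -/
def flipAt {k : ℕ} (ω : Cube k) (i : Fin k) : Cube k := Function.update ω i (-ω i)

/-- The pivotal set of `f` at `ω`. -/
def pivotalSet {k : ℕ} (f : BooleanFunction k) (ω : Cube k) : Finset (Fin k) :=
  Finset.univ.filter fun i => f (flipAt ω i) ≠ f ω

/-! ### The continuous time random walk on the cube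

At every vertex that the walk visits, each of the `k` incident edges carries a fresh independent
exponential clock of rate `1`, and the walk crosses the edge whose clock rings first. -/

/-- The randomness of the walk: the starting vertex `w.1`, and for the `m`-th visited vertex the
ringing time `w.2 m i` of the clock on the incident edge in direction `i`. -/
abbrev WalkSpace (k : ℕ) : Type := Cube k × (ℕ → Fin k → ℝ)

/-- The starting vertex is uniform, all clocks are exponential of rate `1`, and everything is
independent. -/
noncomputable def walkMeasure (k : ℕ) : Measure (WalkSpace k) :=
  (cubeMeasure k).prod
    (Measure.infinitePi fun _ : ℕ => Measure.pi fun _ : Fin k => expMeasure 1)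

namespace WalkSpace

/-- The time that the walk spends at the `m`-th visited vertex, which is the first ringing time of
the clocks there (`∞` if there is no edge, that is, if `k = 0`). -/
noncomputable def holdingTime {k : ℕ} (w : WalkSpace k) (m : ℕ) : ℝ≥0∞ :=
  ⨅ i, ENNReal.ofReal (w.2 m i)

/-- The time of the `(m+1)`-st jump. -/
noncomputable def jumpTime {k : ℕ} (w : WalkSpace k) (m : ℕ) : ℝ≥0∞ :=
  ∑ j ∈ Finset.range (m + 1), w.holdingTime j

open Classical in
/-- The `m`-th visited vertex: at each jump, the coordinate whose clock rings first is flipped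
(almost surely there are no ties). -/
noncomputable def vertex {k : ℕ} (w : WalkSpace k) : ℕ → Cube k
  | 0 => w.1
  | m + 1 => fun i =>
      if ENNReal.ofReal (w.2 m i) = w.holdingTime m then -(w.vertex m i) else w.vertex m i

/-- The number of jumps up to time `t` (almost surely finite). -/
noncomputable def jumpCount {k : ℕ} (w : WalkSpace k) (t : ℝ≥0) : ℕ :=
  {m : ℕ | w.jumpTime m ≤ t}.ncard

/-- The position `X(t)` of the walk at time `t`. -/
noncomputable def position {k : ℕ} (w : WalkSpace k) (t : ℝ≥0) : Cube k :=
  w.vertex (w.jumpCount t)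

end WalkSpace

/-- The number of times a path `h` with values in `{-1,1}` changes its value in the time set `s`:
the supremum, over all finite increasing sequences of times in `s`, of the number of changes seen
along the sequence. -/
noncomputable def numChanges (h : ℝ≥0 → ℤˣ) (s : Set ℝ≥0) : ℕ∞ :=
  ⨆ (m : ℕ) (u : ℕ → ℝ≥0) (_ : Monotone u) (_ : ∀ i, u i ∈ s),
    (((Finset.range m).filter fun i => h (u i) ≠ h (u (i + 1))).card : ℕ∞)

/-- The random number `C` of times that `f(X(t))` changes value in `[0,1]`. -/
noncomputable def changeCount {k : ℕ} (f : BooleanFunction k) (w : WalkSpace k) : ℕ∞ :=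
  numChanges (fun t => f (w.position t)) (Set.Icc 0 1)

/-- A sequence of Boolean functions is volatile if `C_n` tends to infinity in distribution. -/
def Volatile {k : ℕ → ℕ} (f : ∀ n, BooleanFunction (k n)) : Prop :=
  ∀ M : ℕ, Tendsto (fun n => walkMeasure (k n) {w | changeCount (f n) w ≤ M}) atTop (𝓝 0)

/-- Two sequences of Boolean functions are `o(1)`-close if `P[f_n ≠ g_n] → 0`. -/
def AsymptoticallyClose {k : ℕ → ℕ} (f g : ∀ n, BooleanFunction (k n)) : Prop :=
  Tendsto (fun n => cubeMeasure (k n) {ω | f n ω ≠ g n ω}) atTop (𝓝 0)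

/-- `P[|𝒫_n| > a_n] → 1` for some sequence of integers `a_n → ∞`. -/
def HasManyPivotals {k : ℕ → ℕ} (f : ∀ n, BooleanFunction (k n)) : Prop :=
  ∃ a : ℕ → ℕ, Tendsto a atTop atTop ∧
    Tendsto (fun n => cubeMeasure (k n) {ω | a n < (pivotalSet (f n) ω).card}) atTop (𝓝 1)

/-! Two facts carry the theorem. First, many pivotals force volatility (`HasManyPivotals.volatile`).
A jump of the walk from `y` changes `g` with probability at least `|𝒫(y)|/k`, so with `c = 1 - 1/e`
the quantity exp(c · Σ |𝒫|/k - number of changes), summed over visited vertices, is a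
supermartingale. Run about `k/√a` jumps: their expected total duration is about `1/√a`, so they fit
into `[0,1]`; by stationarity at least half of the visited vertices typically have more than `a`
pivotals. The sum is then at least about `√a/2`, and few changes would make the supermartingale
huge, which Markov's inequality forbids (`walkMeasure_changeCount_le`).

Second, any `f` can be perturbed slightly to have many pivotals (`exists_close_many_pivotals`). A
tribes function with somewhat too few tribes gives a monotone `C` that is almost always `1` and yet
has many pivotals with high probability. Let `D` be its dual, almost always `-1`, and take `g = (f ⊓
C) ⊔ D`. Typically `C = 1` and `D = -1`, so `g = f`. Where moreover `f = 1`, the pivotals of `C` are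
pivotal for `g`; where `f = -1`, those of `D` are. Lattice operations preserve monotonicity, so one
construction serves both claims. -/

/-! ### Exponential clocks at one vertex. -/

instance isProbabilityMeasure_expMeasure_one : IsProbabilityMeasure (expMeasure 1) :=
  isProbabilityMeasure_expMeasure one_pos

instance nullSingletonClass_expMeasure (r : ℝ) : NullSingletonClass (expMeasure r) := by
  unfold expMeasure gammaMeasure
  infer_instance

theorem expMeasure_one_Ioi {t : ℝ} (ht : 0 ≤ t) :
    expMeasure 1 (Set.Ioi t) = ENNReal.ofReal (Real.exp (-t)) := by
  have h1 : (expMeasure 1).real (Set.Iic t) = 1 - Real.exp (-t) := by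
    rw [← cdf_eq_real, cdf_expMeasure_eq one_pos, if_pos ht, one_mul]
  have h2 : (expMeasure 1).real (Set.Ioi t) = Real.exp (-t) := by
    rw [← Set.compl_Iic, probReal_compl_eq_one_sub measurableSet_Iic, h1]
    ring
  rw [← h2, ofReal_measureReal]

/-- Resampling one coordinate preserves a product measure. -/
theorem measurePreserving_update_infinitePi {ι : Type*} [DecidableEq ι] {X : Type*}
    [MeasurableSpace X] (μ : Measure X) [IsProbabilityMeasure μ] (m : ι) :
    MeasurePreserving (fun p : (ι → X) × X => Function.update p.1 m p.2)
      ((Measure.infinitePi fun _ : ι => μ).prod μ) (Measure.infinitePi fun _ : ι => μ) := by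
  have hmeas : Measurable fun p : (ι → X) × X => Function.update p.1 m p.2 := by
    refine measurable_pi_lambda _ fun i => ?_
    by_cases hi : i = m
    · subst hi; simpa using measurable_snd
    · simp only [Function.update_of_ne hi]
      exact (measurable_pi_apply i).comp measurable_fst
  refine ⟨hmeas, Measure.eq_infinitePi _ fun s t ht => ?_⟩
  rw [Measure.map_apply hmeas (MeasurableSet.pi s.countable_toSet fun i _ => ht i)]
  by_cases hm : m ∈ s
  · have : (fun p : (ι → X) × X => Function.update p.1 m p.2) ⁻¹' Set.pi s t =
        Set.pi (s.erase m : Finset ι) t ×ˢ t m := by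
      ext p
      simp only [Set.mem_preimage, Set.mem_pi, Finset.mem_coe, Set.mem_prod, Finset.mem_erase]
      constructor
      · intro h
        refine ⟨fun i hi => ?_, by simpa using h m hm⟩
        simpa [Function.update_of_ne hi.1] using h i hi.2
      · rintro ⟨h1, h2⟩ i hi
        by_cases him : i = m
        · subst him; simpa using h2
        · simpa [Function.update_of_ne him] using h1 i ⟨him, hi⟩
    rw [this, Measure.prod_prod, Measure.infinitePi_pi _ fun i _ => ht i,
      Finset.prod_erase_mul _ _ hm]
  · have : (fun p : (ι → X) × X => Function.update p.1 m p.2) ⁻¹' Set.pi s t =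
        Set.pi s t ×ˢ Set.univ := by
      ext p
      simp only [Set.mem_preimage, Set.mem_pi, Finset.mem_coe, Set.mem_prod, Set.mem_univ,
        and_true]
      refine forall₂_congr fun i hi => ?_
      rw [Function.update_of_ne (by rintro rfl; exact hm hi)]
    rw [this, Measure.prod_prod, Measure.infinitePi_pi _ fun i _ => ht i, measure_univ, mul_one]

theorem measurePreserving_update_pi {ι : Type*} [Fintype ι] [DecidableEq ι] {X : Type*}
    [MeasurableSpace X] (μ : Measure X) [IsProbabilityMeasure μ] (m : ι) :
    MeasurePreserving (fun p : (ι → X) × X => Function.update p.1 m p.2)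
      ((Measure.pi fun _ : ι => μ).prod μ) (Measure.pi fun _ : ι => μ) := by
  simpa only [Measure.infinitePi_eq_pi] using measurePreserving_update_infinitePi μ m

/-- The law of the clocks at one vertex. -/
noncomputable abbrev clockMeasure (k : ℕ) : Measure (Fin k → ℝ) :=
  Measure.pi fun _ => expMeasure 1

theorem ae_clock_pos (k : ℕ) : ∀ᵐ x ∂clockMeasure k, ∀ i, 0 < x i := by
  rw [ae_all_iff]
  intro i
  have h : ∀ᵐ t ∂expMeasure 1, (0 : ℝ) < t := by
    have := expMeasure_one_Ioi le_rfl
    rw [neg_zero, Real.exp_zero, ENNReal.ofReal_one] at this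
    exact (mem_ae_iff_prob_eq_one measurableSet_Ioi).2 this
  exact (measurePreserving_eval (fun _ : Fin k => expMeasure 1) i).quasiMeasurePreserving.ae h

/-- Resampling coordinate `i` with all others frozen turns a tie with `j` into hitting a single
point, which is null for a measure without atoms. -/
theorem ae_clock_injective (k : ℕ) : ∀ᵐ x ∂clockMeasure k, Function.Injective x := by
  have h : ∀ i j : Fin k, i ≠ j → ∀ᵐ x ∂clockMeasure k, x i ≠ x j := by
    intro i j hij
    have hset : MeasurableSet {x : Fin k → ℝ | x i = x j} :=
      measurableSet_eq_fun (measurable_pi_apply i) (measurable_pi_apply j)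
    have hp := measurePreserving_update_pi (expMeasure 1) i
    rw [ae_iff]
    simp only [not_not]
    rw [← hp.measure_preimage hset.nullMeasurableSet,
      Measure.measure_prod_null (hp.measurable hset)]
    refine Eventually.of_forall fun x => ?_
    have : (Prod.mk x ⁻¹' ((fun p : (Fin k → ℝ) × ℝ => Function.update p.1 i p.2) ⁻¹'
        {x | x i = x j})) = {x j} := by
      ext y
      simp [Function.update_of_ne hij.symm]
    simp only [this, measure_singleton, Pi.zero_apply]
  have h' : ∀ᵐ x ∂clockMeasure k, ∀ i j : Fin k, i ≠ j → x i ≠ x j := by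
    simp only [ae_all_iff]
    exact h
  filter_upwards [h'] with x hx i j hij
  by_contra hne
  exact hx i j hne hij

/-- The first ringing time. -/
noncomputable def firstRing {k : ℕ} (x : Fin k → ℝ) : ℝ≥0∞ := ⨅ i, ENNReal.ofReal (x i)

theorem measurable_firstRing (k : ℕ) : Measurable (firstRing (k := k)) :=
  Measurable.iInf fun i => ENNReal.measurable_ofReal.comp (measurable_pi_apply i)

theorem exists_eq_firstRing {k : ℕ} (hk : k ≠ 0) (x : Fin k → ℝ) :
    ∃ i, ENNReal.ofReal (x i) = firstRing x := by
  have : Nonempty (Fin k) := ⟨⟨0, Nat.pos_of_ne_zero hk⟩⟩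
  exact exists_eq_ciInf_of_finite

theorem firstRing_ne_top {k : ℕ} (hk : k ≠ 0) (x : Fin k → ℝ) : firstRing x ≠ ∞ := by
  obtain ⟨i, hi⟩ := exists_eq_firstRing hk x
  exact hi ▸ ENNReal.ofReal_ne_top

/-- The minimum of `k` independent rate-one exponentials has tail `exp (-k t)`; integrate the tail.
-/
theorem lintegral_firstRing {k : ℕ} (hk : k ≠ 0) :
    ∫⁻ x, firstRing x ∂clockMeasure k = (k : ℝ≥0∞)⁻¹ := by
  have hk' : (0 : ℝ) < k := by exact_mod_cast Nat.pos_of_ne_zero hk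
  have h1 : ∫⁻ x, firstRing x ∂clockMeasure k =
      ∫⁻ x, ENNReal.ofReal (firstRing x).toReal ∂clockMeasure k :=
    lintegral_congr fun x => (ENNReal.ofReal_toReal (firstRing_ne_top hk x)).symm
  rw [h1, lintegral_eq_lintegral_meas_lt _ (Eventually.of_forall fun x => ENNReal.toReal_nonneg)
    (measurable_firstRing k).ennreal_toReal.aemeasurable]
  have h2 : ∀ t ∈ Set.Ioi (0 : ℝ), clockMeasure k {x | t < (firstRing x).toReal} =
      ENNReal.ofReal (Real.exp (-k * t)) := by
    intro t ht
    have : {x : Fin k → ℝ | t < (firstRing x).toReal} = Set.univ.pi fun _ => Set.Ioi t := by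
      ext x
      simp only [Set.mem_ofPred_eq, Set.mem_pi, Set.mem_univ, true_imp_iff, Set.mem_Ioi]
      rw [← ENNReal.ofReal_lt_iff_lt_toReal (le_of_lt ht) (firstRing_ne_top hk x)]
      constructor
      · intro h i
        exact (ENNReal.ofReal_lt_ofReal_iff_of_nonneg (le_of_lt ht)).1
          (h.trans_le (iInf_le _ i))
      · intro h
        obtain ⟨i, hi⟩ := exists_eq_firstRing hk x
        rw [← hi]
        exact (ENNReal.ofReal_lt_ofReal_iff_of_nonneg (le_of_lt ht)).2 (h i)
    rw [this, Measure.pi_pi]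
    simp only [expMeasure_one_Ioi (le_of_lt ht), Finset.prod_const, Finset.card_univ,
      Fintype.card_fin]
    rw [← ENNReal.ofReal_pow (Real.exp_pos _).le, ← Real.exp_nat_mul]
    congr 2
    ring
  rw [setLIntegral_congr_fun measurableSet_Ioi h2,
    ← ofReal_integral_eq_lintegral_ofReal
      (integrableOn_exp_mul_Ioi (by linarith : -(k : ℝ) < 0) 0)
      (Eventually.of_forall fun t => (Real.exp_pos _).le),
    integral_exp_mul_Ioi (by linarith : -(k : ℝ) < 0)]
  rw [mul_zero, Real.exp_zero, neg_div_neg_eq, one_div, ENNReal.ofReal_inv_of_pos hk',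
    ENNReal.ofReal_natCast]

theorem measurableSet_eq_firstRing {k : ℕ} (i : Fin k) :
    MeasurableSet {x : Fin k → ℝ | ENNReal.ofReal (x i) = firstRing x} :=
  measurableSet_eq_fun (ENNReal.measurable_ofReal.comp (measurable_pi_apply i))
    (measurable_firstRing k)

/-- The `k` events are equally likely by swapping coordinates, and they cover the space. Only the
lower bound is needed, so ties can be ignored here. -/
theorem inv_le_clockMeasure_eq_firstRing {k : ℕ} (i : Fin k) :
    (k : ℝ≥0∞)⁻¹ ≤ clockMeasure k {x | ENNReal.ofReal (x i) = firstRing x} := by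
  have hk : k ≠ 0 := by rintro rfl; exact i.elim0
  have hsymm : ∀ j, clockMeasure k {x | ENNReal.ofReal (x j) = firstRing x} =
      clockMeasure k {x | ENNReal.ofReal (x i) = firstRing x} := by
    intro j
    have hp := measurePreserving_piCongrLeft (fun _ : Fin k => expMeasure 1) (Equiv.swap i j)
    rw [← hp.measure_preimage (measurableSet_eq_firstRing j).nullMeasurableSet]
    congr 1
    ext x
    have hx : ∀ l, MeasurableEquiv.piCongrLeft (fun _ => ℝ) (Equiv.swap i j) x l =
        x (Equiv.swap i j l) := by
      intro l
      have := Equiv.piCongrLeft_apply_apply (fun _ : Fin k => ℝ) (Equiv.swap i j) x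
        (Equiv.swap i j l)
      rwa [Equiv.swap_apply_self] at this
    simp only [Set.mem_preimage, Set.mem_ofPred_eq, firstRing, hx, Equiv.swap_apply_right]
    rw [(Equiv.swap i j).iInf_comp (g := fun l => ENNReal.ofReal (x l))]
  have hone : 1 ≤ (k : ℝ≥0∞) * clockMeasure k {x | ENNReal.ofReal (x i) = firstRing x} := by
    calc (1 : ℝ≥0∞) = clockMeasure k Set.univ := measure_univ.symm
      _ ≤ clockMeasure k (⋃ j, {x | ENNReal.ofReal (x j) = firstRing x}) :=
          measure_mono fun x _ => Set.mem_iUnion.2 (exists_eq_firstRing hk x)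
      _ ≤ ∑ j, clockMeasure k {x | ENNReal.ofReal (x j) = firstRing x} :=
          measure_iUnion_fintype_le _ _
      _ = _ := by simp [hsymm]
  rw [← one_div]
  exact ENNReal.div_le_of_le_mul' hone

/-! ### A single jump of the walk. -/

open Classical in
/-- The position after one jump from `y` with clocks `x`. -/
noncomputable def nextVertex {k : ℕ} (y : Cube k) (x : Fin k → ℝ) : Cube k :=
  fun i => if ENNReal.ofReal (x i) = firstRing x then -(y i) else y i

theorem WalkSpace.vertex_succ {k : ℕ} (w : WalkSpace k) (m : ℕ) :
    w.vertex (m + 1) = nextVertex (w.vertex m) (w.2 m) := rfl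

/-- For fixed clocks a jump flips a fixed set of coordinates, ties or not. This is the source of
stationarity. -/
theorem nextVertex_injective {k : ℕ} (x : Fin k → ℝ) :
    Function.Injective fun y : Cube k => nextVertex y x := by
  intro y z h
  funext i
  have := congrFun h i
  simp only [nextVertex] at this
  split_ifs at this
  · exact neg_injective this
  · exact this

theorem measurable_nextVertex {k : ℕ} (y : Cube k) :
    Measurable fun x : Fin k → ℝ => nextVertex y x :=
  measurable_pi_lambda _ fun i =>
    Measurable.ite (measurableSet_eq_firstRing i) measurable_const measurable_const

theorem nextVertex_eq_flipAt {k : ℕ} (y : Cube k) {x : Fin k → ℝ} (hpos : ∀ i, 0 < x i)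
    (hinj : Function.Injective x) {i : Fin k} (hi : ENNReal.ofReal (x i) = firstRing x) :
    nextVertex y x = flipAt y i := by
  have key : ∀ j, ENNReal.ofReal (x j) = firstRing x → j = i := fun j hj =>
    hinj ((ENNReal.ofReal_eq_ofReal_iff (hpos j).le (hpos i).le).1 (hj.trans hi.symm))
  funext j
  by_cases hj : j = i
  · subst hj
    simp [nextVertex, hi, flipAt]
  · rw [flipAt, Function.update_of_ne hj, nextVertex, if_neg fun h => hj (key j h)]

/-- The probability that a jump from `y` changes the value of `g`. -/
theorem card_pivotalSet_le_clockMeasure {k : ℕ} (g : BooleanFunction k) (y : Cube k) :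
    ((pivotalSet g y).card : ℝ≥0∞) * (k : ℝ≥0∞)⁻¹ ≤
      clockMeasure k {x | g (nextVertex y x) ≠ g y} := by
  set E : Fin k → Set (Fin k → ℝ) := fun i => {x | ENNReal.ofReal (x i) = firstRing x} with hE
  have hgood : ∀ᵐ x ∂clockMeasure k, (∀ i, 0 < x i) ∧ Function.Injective x :=
    (ae_clock_pos k).and (ae_clock_injective k)
  calc ((pivotalSet g y).card : ℝ≥0∞) * (k : ℝ≥0∞)⁻¹
      = ∑ _i ∈ pivotalSet g y, (k : ℝ≥0∞)⁻¹ := by rw [Finset.sum_const, nsmul_eq_mul]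
    _ ≤ ∑ i ∈ pivotalSet g y, clockMeasure k (E i) :=
        Finset.sum_le_sum fun i _ => inv_le_clockMeasure_eq_firstRing i
    _ = clockMeasure k (⋃ i ∈ pivotalSet g y, E i) := by
        refine (measure_biUnion_finset₀ ?_
          fun i _ => (measurableSet_eq_firstRing i).nullMeasurableSet).symm
        intro i _ j _ hij
        refine measure_mono_null (t := {x | ¬((∀ i, 0 < x i) ∧ Function.Injective x)}) ?_
          (ae_iff.1 hgood)
        rintro x ⟨hi, hj⟩ ⟨hpos, hinj⟩
        exact hij (hinj ((ENNReal.ofReal_eq_ofReal_iff (hpos i).le (hpos j).le).1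
          (Eq.trans hi (Eq.symm hj))))
    _ ≤ clockMeasure k {x | g (nextVertex y x) ≠ g y} := by
        refine measure_mono_ae ?_
        filter_upwards [hgood] with x hx hmem
        obtain ⟨i, hi, hxi⟩ := Set.mem_iUnion₂.1 hmem
        change g (nextVertex y x) ≠ g y
        rw [nextVertex_eq_flipAt y hx.1 hx.2 hxi]
        exact (Finset.mem_filter.1 hi).2

open Classical in
/-- The factor contributed by one jump to the exponential supermartingale. -/
noncomputable def jumpWeight {k : ℕ} (g : BooleanFunction k) (y : Cube k) (x : Fin k → ℝ) :
    ℝ≥0∞ :=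
  ENNReal.ofReal (Real.exp ((1 - Real.exp (-1)) * ((pivotalSet g y).card / k))) *
    if g (nextVertex y x) ≠ g y then ENNReal.ofReal (Real.exp (-1)) else 1

theorem measurableSet_change {k : ℕ} (g : BooleanFunction k) (y : Cube k) :
    MeasurableSet {x : Fin k → ℝ | g (nextVertex y x) ≠ g y} :=
  measurable_nextVertex y (.of_discrete (s := {z | g z ≠ g y}))

theorem measurable_jumpWeight {k : ℕ} (g : BooleanFunction k) (y : Cube k) :
    Measurable (jumpWeight g y) :=
  (Measurable.ite (measurableSet_change g y) measurable_const measurable_const).const_mul _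

/-- The integral is `1 - c μ(S) ≤ 1 - c p ≤ exp (-c p)`. It serves twice: for jumps that change `g`,
and for critical blocks. -/
theorem lintegral_ite_exp_neg_one_le {Ω : Type*} [MeasurableSpace Ω] (μ : Measure Ω)
    [IsProbabilityMeasure μ] {S : Set Ω} (hS : MeasurableSet S) [DecidablePred (· ∈ S)] {p : ℝ}
    (hp : p ≤ μ.real S) :
    ∫⁻ x, (if x ∈ S then ENNReal.ofReal (Real.exp (-1)) else 1) ∂μ ≤
      ENNReal.ofReal (Real.exp (-((1 - Real.exp (-1)) * p))) := by
  set c : ℝ := 1 - Real.exp (-1) with hc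
  have hc0 : 0 ≤ c := by rw [hc, sub_nonneg, Real.exp_le_one_iff]; norm_num
  have hq1 : μ.real S ≤ 1 := measureReal_le_one
  have hin : Set.EqOn (fun x => if x ∈ S then ENNReal.ofReal (Real.exp (-1)) else 1)
      (fun _ => ENNReal.ofReal (Real.exp (-1))) S := fun x hx => if_pos hx
  have hout : Set.EqOn (fun x => if x ∈ S then ENNReal.ofReal (Real.exp (-1)) else 1)
      (fun _ => 1) Sᶜ := fun x hx => if_neg hx
  rw [← lintegral_add_compl _ hS, setLIntegral_congr_fun hS hin,
    setLIntegral_congr_fun hS.compl hout, setLIntegral_const, setLIntegral_const,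
    ← ofReal_measureReal (s := S), ← ofReal_measureReal (s := Sᶜ), probReal_compl_eq_one_sub hS,
    one_mul, ← ENNReal.ofReal_mul (Real.exp_pos _).le,
    ← ENNReal.ofReal_add (by positivity) (by linarith)]
  refine ENNReal.ofReal_le_ofReal ?_
  have := Real.add_one_le_exp (-(c * p))
  have := mul_le_mul_of_nonneg_left hp hc0
  rw [hc] at *
  linarith

/-- The one-step supermartingale inequality: the deterministic prefactor exactly offsets the bound
`exp (-c p)` with `p = |𝒫(y)|/k`. -/
theorem lintegral_jumpWeight_le {k : ℕ} (g : BooleanFunction k) (y : Cube k) :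
    ∫⁻ x, jumpWeight g y x ∂clockMeasure k ≤ 1 := by
  have hp : ((pivotalSet g y).card / k : ℝ) ≤
      (clockMeasure k).real {x | g (nextVertex y x) ≠ g y} := by
    have h := ENNReal.toReal_mono (measure_ne_top _ _) (card_pivotalSet_le_clockMeasure g y)
    rw [ENNReal.toReal_mul, ENNReal.toReal_natCast, ENNReal.toReal_inv,
      ENNReal.toReal_natCast, ← div_eq_mul_inv] at h
    exact h
  unfold jumpWeight
  rw [lintegral_const_mul' _ _ ENNReal.ofReal_ne_top]
  refine (mul_le_mul_right (lintegral_ite_exp_neg_one_le _ (measurableSet_change g y) hp) _).trans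
    ?_
  rw [← ENNReal.ofReal_mul (Real.exp_pos _).le, ← Real.exp_add, add_neg_cancel, Real.exp_zero,
    ENNReal.ofReal_one]

/-! ### The sequence of visited vertices and its stationarity. -/

theorem WalkSpace.vertex_update {k : ℕ} (ω : Cube k) (x : ℕ → Fin k → ℝ) (n : ℕ)
    (y : Fin k → ℝ) {m : ℕ} (hm : m ≤ n) :
    vertex (k := k) (ω, Function.update x n y) m = vertex (k := k) (ω, x) m := by
  induction m with
  | zero => rfl
  | succ m ih =>
    rw [vertex_succ, vertex_succ, ih (by omega)]
    simp only [Function.update_of_ne (by omega : m ≠ n)]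

theorem WalkSpace.vertex_injective {k : ℕ} (x : ℕ → Fin k → ℝ) (m : ℕ) :
    Function.Injective fun ω : Cube k => vertex (k := k) (ω, x) m := by
  induction m with
  | zero => exact fun _ _ h => h
  | succ m ih =>
    exact fun a b h => ih (nextVertex_injective (x m) h)

theorem WalkSpace.measurable_vertex {k : ℕ} (m : ℕ) :
    Measurable fun w : WalkSpace k => w.vertex m := by
  induction m with
  | zero => exact measurable_fst
  | succ m ih =>
    have h : Measurable fun p : Cube k × (Fin k → ℝ) => nextVertex p.1 p.2 :=
      measurable_from_prod_countable_right fun y => measurable_nextVertex y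
    exact h.comp (ih.prodMk ((measurable_pi_apply m).comp measurable_snd))

instance isProbabilityMeasure_cubeMeasure (k : ℕ) : IsProbabilityMeasure (cubeMeasure k) :=
  isProbabilityMeasure_uniformOn Set.finite_univ Set.univ_nonempty

theorem cubeMeasure_preimage {k : ℕ} {e : Cube k → Cube k} (he : Function.Injective e)
    (B : Set (Cube k)) : cubeMeasure k (e ⁻¹' B) = cubeMeasure k B := by
  have hb : Function.Bijective e := Finite.injective_iff_bijective.1 he
  rw [cubeMeasure, uniformOn_univ, uniformOn_univ, Measure.count_apply .of_discrete,
    Measure.count_apply .of_discrete, ← he.encard_image, Set.image_preimage_eq _ hb.2]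

/-- The walk is stationary. -/
theorem walkMeasure_vertex_mem {k : ℕ} (m : ℕ) (B : Set (Cube k)) :
    walkMeasure k {w | w.vertex m ∈ B} = cubeMeasure k B := by
  have hm : MeasurableSet {w : WalkSpace k | w.vertex m ∈ B} :=
    WalkSpace.measurable_vertex m .of_discrete
  rw [walkMeasure, Measure.prod_apply_symm hm]
  have : ∀ x : ℕ → Fin k → ℝ,
      cubeMeasure k ((fun ω => (ω, x)) ⁻¹' {w : WalkSpace k | w.vertex m ∈ B}) =
        cubeMeasure k B :=
    fun x => cubeMeasure_preimage (WalkSpace.vertex_injective x m) B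
  simp only [this, lintegral_const, measure_univ, mul_one]

/-! ### The supermartingale bound. -/

/-- The exponential supermartingale of the walk. -/
noncomputable def walkWeight {k : ℕ} (g : BooleanFunction k) (n : ℕ) (w : WalkSpace k) : ℝ≥0∞ :=
  ∏ m ∈ Finset.range n, jumpWeight g (w.vertex m) (w.2 m)

theorem measurable_uncurry_jumpWeight {k : ℕ} (g : BooleanFunction k) :
    Measurable fun p : Cube k × (Fin k → ℝ) => jumpWeight g p.1 p.2 :=
  measurable_from_prod_countable_right fun y => measurable_jumpWeight g y

theorem measurable_vertex_clock {k : ℕ} (m : ℕ) :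
    Measurable fun w : WalkSpace k => (w.vertex m, w.2 m) :=
  (WalkSpace.measurable_vertex m).prodMk ((measurable_pi_apply m).comp measurable_snd)

theorem measurable_walkWeight_factor {k : ℕ} (g : BooleanFunction k) (m : ℕ) :
    Measurable fun w : WalkSpace k => jumpWeight g (w.vertex m) (w.2 m) := by
  simpa only [Function.comp_def] using
    (measurable_uncurry_jumpWeight g).comp (measurable_vertex_clock m)

theorem measurable_walkWeight {k : ℕ} (g : BooleanFunction k) (n : ℕ) :
    Measurable (walkWeight g n) := by
  induction n with
  | zero => exact measurable_const (a := (1 : ℝ≥0∞))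
  | succ n ih =>
    have : walkWeight g (n + 1) =
        fun w => walkWeight g n w * jumpWeight g (w.vertex n) (w.2 n) := by
      funext w
      simp only [walkWeight, Finset.prod_range_succ]
    rw [this]
    exact ih.mul (measurable_walkWeight_factor g n)

/-- Resampling the `n`-th clock vector plays the role of conditioning on the past: the first `n`
factors and the `n`-th vertex do not see it, so integrating it out costs a factor at most `1`. -/
theorem lintegral_walkWeight_start_le {k : ℕ} (g : BooleanFunction k) (ω : Cube k)
    (n : ℕ) :
    ∫⁻ x, walkWeight g n (ω, x) ∂(Measure.infinitePi fun _ : ℕ => clockMeasure k) ≤ 1 := by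
  induction n with
  | zero => simp [walkWeight]
  | succ n ih =>
    have hp := measurePreserving_update_infinitePi (clockMeasure k) n
    have hmeas : Measurable fun x : ℕ → Fin k → ℝ => walkWeight g (n + 1) (ω, x) :=
      (measurable_walkWeight g (n + 1)).comp measurable_prodMk_left
    rw [← hp.lintegral_comp hmeas, lintegral_prod (fun p : (ℕ → Fin k → ℝ) × (Fin k → ℝ) =>
        walkWeight g (n + 1) (ω, Function.update p.1 n p.2))
        (hmeas.comp hp.measurable).aemeasurable]
    refine le_trans (lintegral_mono fun x => ?_) ih
    have : ∀ y, walkWeight g (n + 1) (ω, Function.update x n y) =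
        walkWeight g n (ω, x) * jumpWeight g (WalkSpace.vertex (k := k) (ω, x) n) y := by
      intro y
      unfold walkWeight
      rw [Finset.prod_range_succ]
      congr 1
      · refine Finset.prod_congr rfl fun m hm => ?_
        have hm' := Finset.mem_range.1 hm
        rw [WalkSpace.vertex_update ω x n y hm'.le]
        simp only [Function.update_of_ne hm'.ne]
      · rw [WalkSpace.vertex_update ω x n y le_rfl]
        simp only [Function.update_self]
    simp only [this]
    rw [lintegral_const_mul _ (measurable_jumpWeight g _)]
    exact mul_le_of_le_one_right' (lintegral_jumpWeight_le g _)

theorem lintegral_walkWeight_le {k : ℕ} (g : BooleanFunction k) (n : ℕ) :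
    ∫⁻ w, walkWeight g n w ∂walkMeasure k ≤ 1 := by
  rw [walkMeasure, lintegral_prod _ (measurable_walkWeight g n).aemeasurable]
  calc _ ≤ ∫⁻ _, 1 ∂cubeMeasure k :=
        lintegral_mono fun ω => lintegral_walkWeight_start_le g ω n
    _ = 1 := by simp

/-! ### From jumps to continuous time. -/

theorem WalkSpace.measurable_holdingTime {k : ℕ} (m : ℕ) :
    Measurable fun w : WalkSpace k => w.holdingTime m :=
  (measurable_firstRing k).comp ((measurable_pi_apply m).comp measurable_snd)

theorem lintegral_holdingTime {k : ℕ} (hk : k ≠ 0) (m : ℕ) :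
    ∫⁻ w, WalkSpace.holdingTime w m ∂walkMeasure k = (k : ℝ≥0∞)⁻¹ := by
  rw [walkMeasure, lintegral_prod _ (WalkSpace.measurable_holdingTime m).aemeasurable]
  have : ∫⁻ x, firstRing (x m) ∂(Measure.infinitePi fun _ : ℕ => clockMeasure k) =
      (k : ℝ≥0∞)⁻¹ := by
    rw [← lintegral_firstRing hk]
    exact (measurePreserving_eval_infinitePi (fun _ : ℕ => clockMeasure k) m).lintegral_comp
      (measurable_firstRing k)
  change ∫⁻ _, ∫⁻ x, firstRing (x m) ∂(Measure.infinitePi fun _ : ℕ => clockMeasure k)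
    ∂cubeMeasure k = _
  simp [this]

/-- The time of arrival at the `n`-th visited vertex. -/
noncomputable def WalkSpace.arrivalTime {k : ℕ} (w : WalkSpace k) (n : ℕ) : ℝ≥0∞ :=
  ∑ j ∈ Finset.range n, w.holdingTime j

theorem WalkSpace.measurable_arrivalTime {k : ℕ} (n : ℕ) :
    Measurable fun w : WalkSpace k => w.arrivalTime n :=
  Finset.measurable_fun_sum _ fun j _ => WalkSpace.measurable_holdingTime j

theorem lintegral_arrivalTime {k : ℕ} (hk : k ≠ 0) (n : ℕ) :
    ∫⁻ w, WalkSpace.arrivalTime w n ∂walkMeasure k = (n : ℝ≥0∞) * (k : ℝ≥0∞)⁻¹ := by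
  unfold WalkSpace.arrivalTime
  rw [lintegral_finsetSum _ fun j _ => WalkSpace.measurable_holdingTime j]
  simp only [lintegral_holdingTime hk, Finset.sum_const, Finset.card_range, nsmul_eq_mul]

theorem ae_holdingTime_pos {k : ℕ} (hk : k ≠ 0) :
    ∀ᵐ w ∂walkMeasure k, ∀ m, 0 < WalkSpace.holdingTime w m := by
  rw [ae_all_iff]
  intro m
  have h : ∀ᵐ x ∂clockMeasure k, 0 < firstRing x := by
    filter_upwards [ae_clock_pos k] with x hx
    obtain ⟨i, hi⟩ := exists_eq_firstRing hk x
    rw [← hi]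
    exact ENNReal.ofReal_pos.2 (hx i)
  have hq := (measurePreserving_eval_infinitePi
    (fun _ : ℕ => clockMeasure k) m).quasiMeasurePreserving.ae h
  exact Measure.quasiMeasurePreserving_snd.ae hq

theorem WalkSpace.arrivalTime_lt_succ {k : ℕ} (hk : k ≠ 0) {w : WalkSpace k}
    (hpos : ∀ m, 0 < w.holdingTime m) : StrictMono w.arrivalTime := by
  refine strictMono_nat_of_lt_succ fun n => ?_
  rw [arrivalTime, arrivalTime, Finset.sum_range_succ]
  refine ENNReal.lt_add_right ?_ (hpos n).ne'
  exact ENNReal.sum_ne_top.2 fun j _ => firstRing_ne_top hk (w.2 j)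

/-- `jumpTime m` is `arrivalTime (m + 1)`, and arrival times increase strictly, so exactly `n` jumps
have occurred by the `n`-th arrival. -/
theorem WalkSpace.position_arrivalTime {k : ℕ} (hk : k ≠ 0) {w : WalkSpace k}
    (hpos : ∀ m, 0 < w.holdingTime m) (n : ℕ) :
    w.position (w.arrivalTime n).toNNReal = w.vertex n := by
  have hfin : w.arrivalTime n ≠ ∞ :=
    ENNReal.sum_ne_top.2 fun j _ => firstRing_ne_top hk (w.2 j)
  have hset : {m : ℕ | w.jumpTime m ≤ ((w.arrivalTime n).toNNReal : ℝ≥0∞)} = Set.Iio n := by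
    ext m
    rw [ENNReal.coe_toNNReal hfin]
    change w.arrivalTime (m + 1) ≤ w.arrivalTime n ↔ m < n
    rw [(arrivalTime_lt_succ hk hpos).le_iff_le, Nat.succ_le_iff]
  rw [position, jumpCount, hset, ← Finset.coe_Iio, Set.ncard_coe_finset, Nat.card_Iio]

/-- The number of the first `n` jumps that change the value of `g`. -/
noncomputable def chainChanges {k : ℕ} (g : BooleanFunction k) (n : ℕ) (w : WalkSpace k) : ℕ :=
  ((Finset.range n).filter fun m => g (nextVertex (w.vertex m) (w.2 m)) ≠ g (w.vertex m)).card

theorem chainChanges_le_changeCount {k : ℕ} (hk : k ≠ 0) (g : BooleanFunction k) {n : ℕ}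
    {w : WalkSpace k} (hpos : ∀ m, 0 < w.holdingTime m) (hn : w.arrivalTime n ≤ 1) :
    (chainChanges g n w : ℕ∞) ≤ changeCount g w := by
  have hmono := (WalkSpace.arrivalTime_lt_succ hk hpos).monotone
  have hfin : ∀ m, w.arrivalTime m ≠ ∞ := fun m =>
    ENNReal.sum_ne_top.2 fun j _ => firstRing_ne_top hk (w.2 j)
  -- `numChanges` asks for an infinite sequence in `[0,1]`; freezing it at the `n`-th arrival keeps
  -- it there without affecting the first `n` steps.
  set u : ℕ → ℝ≥0 := fun i => (w.arrivalTime (min i n)).toNNReal with hu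
  have hum : Monotone u := fun i j hij =>
    ENNReal.toNNReal_mono (hfin _) (hmono (min_le_min_right n hij))
  have hus : ∀ i, u i ∈ Set.Icc (0 : ℝ≥0) 1 := fun i =>
    ⟨zero_le, ENNReal.toNNReal_mono ENNReal.one_ne_top ((hmono (min_le_right i n)).trans hn)⟩
  have hcard : chainChanges g n w = ((Finset.range n).filter fun i =>
      g (w.position (u i)) ≠ g (w.position (u (i + 1)))).card := by
    unfold chainChanges
    congr 1
    refine Finset.filter_congr fun i hi => ?_
    have hi' := Finset.mem_range.1 hi
    simp only [hu, WalkSpace.position_arrivalTime hk hpos, min_eq_left hi'.le,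
      min_eq_left (Nat.succ_le_of_lt hi'), WalkSpace.vertex_succ]
    exact ne_comm
  rw [hcard, changeCount, numChanges]
  exact le_iSup_of_le n (le_iSup_of_le u (le_iSup_of_le hum (le_iSup_of_le hus le_rfl)))

open Classical in
theorem walkWeight_eq_exp {k : ℕ} (g : BooleanFunction k) (n : ℕ) (w : WalkSpace k) :
    walkWeight g n w = ENNReal.ofReal (Real.exp ((1 - Real.exp (-1)) *
      ∑ m ∈ Finset.range n, ((pivotalSet g (w.vertex m)).card / k : ℝ) - chainChanges g n w)) := by
  have h : ∀ m, jumpWeight g (w.vertex m) (w.2 m) = ENNReal.ofReal (Real.exp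
      ((1 - Real.exp (-1)) * ((pivotalSet g (w.vertex m)).card / k) -
        if g (nextVertex (w.vertex m) (w.2 m)) ≠ g (w.vertex m) then 1 else 0)) := by
    intro m
    unfold jumpWeight
    split_ifs
    · rw [← ENNReal.ofReal_mul (Real.exp_pos _).le, ← Real.exp_add, ← sub_eq_add_neg]
    · rw [sub_zero, mul_one]
  unfold walkWeight
  simp only [h]
  rw [← ENNReal.ofReal_prod_of_nonneg fun m _ => (Real.exp_pos _).le, ← Real.exp_sum,
    Finset.sum_sub_distrib, ← Finset.mul_sum, Finset.sum_boole]
  unfold chainChanges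
  congr!

/-! ### Visits to vertices with few pivotals, and volatility. -/

open Classical in
/-- The number of the first `n` visited vertices that lie in `B`. -/
noncomputable def visits {k : ℕ} (B : Set (Cube k)) (n : ℕ) (w : WalkSpace k) : ℕ :=
  ((Finset.range n).filter fun m => w.vertex m ∈ B).card

theorem visits_eq_sum {k : ℕ} (B : Set (Cube k)) (n : ℕ) (w : WalkSpace k) :
    (visits B n w : ℝ≥0∞) =
      ∑ m ∈ Finset.range n, ({w : WalkSpace k | w.vertex m ∈ B}).indicator 1 w := by
  classical
  rw [visits, ← Finset.sum_boole]
  refine Finset.sum_congr rfl fun m _ => ?_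
  simp [Set.indicator_apply]

theorem measurable_visits {k : ℕ} (B : Set (Cube k)) (n : ℕ) :
    Measurable fun w : WalkSpace k => (visits B n w : ℝ≥0∞) := by
  simp only [visits_eq_sum]
  exact Finset.measurable_fun_sum _ fun m _ =>
    measurable_one.indicator (WalkSpace.measurable_vertex m .of_discrete)

theorem lintegral_visits {k : ℕ} (B : Set (Cube k)) (n : ℕ) :
    ∫⁻ w, (visits B n w : ℝ≥0∞) ∂walkMeasure k = n * cubeMeasure k B := by
  simp only [visits_eq_sum]
  have hm : ∀ m, MeasurableSet {w : WalkSpace k | w.vertex m ∈ B} :=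
    fun m => WalkSpace.measurable_vertex m .of_discrete
  rw [lintegral_finsetSum _ fun m _ => measurable_one.indicator (hm m)]
  simp only [lintegral_indicator_one (hm _), walkMeasure_vertex_mem, Finset.sum_const,
    Finset.card_range, nsmul_eq_mul]

/-- At least `n/2` of the visited vertices have more than `a` pivotals, and each of them contributes
at least `a/k`. -/
theorem le_sum_card_pivotalSet {k : ℕ} (g : BooleanFunction k) (a n : ℕ) (w : WalkSpace k)
    (h : 2 * visits {ω | (pivotalSet g ω).card ≤ a} n w ≤ n) :
    (n * a / (2 * k) : ℝ) ≤
      ∑ m ∈ Finset.range n, ((pivotalSet g (w.vertex m)).card / k : ℝ) := by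
  classical
  have h1 : ∀ m ∈ Finset.range n, (a / k : ℝ) * (1 - if w.vertex m ∈
      {ω | (pivotalSet g ω).card ≤ a} then 1 else 0) ≤
      ((pivotalSet g (w.vertex m)).card / k : ℝ) := by
    intro m _
    split_ifs with hm
    · rw [sub_self, mul_zero]; positivity
    · rw [sub_zero, mul_one]
      have : a ≤ (pivotalSet g (w.vertex m)).card := le_of_lt (not_le.1 hm)
      gcongr
  refine le_trans ?_ (Finset.sum_le_sum h1)
  rw [← Finset.mul_sum, Finset.sum_sub_distrib, Finset.sum_boole]
  simp only [Finset.sum_const, Finset.card_range, nsmul_eq_mul, mul_one]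
  have h2 : (2 : ℝ) * ((Finset.range n).filter fun m => w.vertex m ∈
      {ω | (pivotalSet g ω).card ≤ a}).card ≤ n := by
    have h' : (2 : ℝ) * visits {ω | (pivotalSet g ω).card ≤ a} n w ≤ n := by exact_mod_cast h
    unfold visits at h'
    convert h'
  have h3 : (n * a / (2 * k) : ℝ) = (a / k : ℝ) * (n / 2) := by
    rw [div_mul_div_comm, mul_comm (a : ℝ), mul_comm (k : ℝ)]
  rw [h3]
  refine mul_le_mul_of_nonneg_left ?_ (by positivity)
  linarith

/-- Few changes force one of three events, each bounded by Markov: the `n` jumps take too long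
(`A1`), half of the visited vertices are poor in pivotals (`A2`), or the supermartingale is large
(`A3`). -/
theorem walkMeasure_changeCount_le {k : ℕ} (hk : k ≠ 0) (g : BooleanFunction k) {n : ℕ}
    (hn : n ≠ 0) (a M : ℕ) :
    walkMeasure k {w | changeCount g w ≤ M} ≤
      n * (k : ℝ≥0∞)⁻¹ + 2 * cubeMeasure k {ω | (pivotalSet g ω).card ≤ a} +
        ENNReal.ofReal (Real.exp (M - (1 - Real.exp (-1)) * (n * a / (2 * k)))) := by
  set c : ℝ := 1 - Real.exp (-1) with hc
  have hc0 : 0 ≤ c := by rw [hc, sub_nonneg, Real.exp_le_one_iff]; norm_num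
  set B : Set (Cube k) := {ω | (pivotalSet g ω).card ≤ a} with hB
  set T : ℝ := c * (n * a / (2 * k)) - M with hT
  set A1 : Set (WalkSpace k) := {w | 1 ≤ w.arrivalTime n}
  set A2 : Set (WalkSpace k) := {w | (n : ℝ≥0∞) ≤ 2 * visits B n w}
  set A3 : Set (WalkSpace k) := {w | ENNReal.ofReal (Real.exp T) ≤ walkWeight g n w}
  have h1 : walkMeasure k A1 ≤ n * (k : ℝ≥0∞)⁻¹ := by
    have := mul_meas_ge_le_lintegral (μ := walkMeasure k)
      (WalkSpace.measurable_arrivalTime (k := k) n) 1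
    rwa [one_mul, lintegral_arrivalTime hk] at this
  have h2 : walkMeasure k A2 ≤ 2 * cubeMeasure k B := by
    have hn' : (n : ℝ≥0∞) ≠ 0 := by exact_mod_cast hn
    have := meas_ge_le_lintegral_div (μ := walkMeasure k)
      ((measurable_visits B n).const_mul 2).aemeasurable hn' (ENNReal.natCast_ne_top n)
    rw [lintegral_const_mul _ (measurable_visits B n), lintegral_visits, mul_left_comm,
      mul_comm (n : ℝ≥0∞), ENNReal.mul_div_cancel_right hn' (ENNReal.natCast_ne_top n)] at this
    exact this
  have h3 : walkMeasure k A3 ≤ ENNReal.ofReal (Real.exp (M - c * (n * a / (2 * k)))) := by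
    have hT0 : ENNReal.ofReal (Real.exp T) ≠ 0 := (ENNReal.ofReal_pos.2 (Real.exp_pos _)).ne'
    refine (meas_ge_le_lintegral_div (μ := walkMeasure k)
      (measurable_walkWeight g n).aemeasurable hT0 ENNReal.ofReal_ne_top).trans ?_
    refine (ENNReal.div_le_div_right (lintegral_walkWeight_le g n) _).trans ?_
    rw [one_div, ← ENNReal.ofReal_inv_of_pos (Real.exp_pos _), ← Real.exp_neg, hT, neg_sub]
  calc walkMeasure k {w | changeCount g w ≤ M} ≤ walkMeasure k (A1 ∪ A2 ∪ A3) := by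
        refine measure_mono_ae ?_
        filter_upwards [ae_holdingTime_pos hk] with w hpos hw
        change changeCount g w ≤ M at hw
        by_contra hcon
        change w ∉ A1 ∪ A2 ∪ A3 at hcon
        simp only [Set.mem_union, not_or] at hcon
        obtain ⟨⟨hA1, hA2⟩, hA3⟩ := hcon
        have hv : 2 * visits B n w ≤ n := by
          have : (2 * visits B n w : ℝ≥0∞) ≤ n := (not_le.1 hA2).le
          exact_mod_cast this
        have hch : (chainChanges g n w : ℝ) ≤ M := by
          have := (chainChanges_le_changeCount hk g hpos (not_le.1 hA1).le).trans hw
          exact_mod_cast this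
        refine hA3 ?_
        change ENNReal.ofReal (Real.exp T) ≤ walkWeight g n w
        rw [walkWeight_eq_exp]
        refine ENNReal.ofReal_le_ofReal (Real.exp_le_exp.2 ?_)
        have := mul_le_mul_of_nonneg_left (le_sum_card_pivotalSet g a n w hv) hc0
        rw [hT]
        linarith
    _ ≤ walkMeasure k A1 + walkMeasure k A2 + walkMeasure k A3 :=
        (measure_union_le _ _).trans (add_le_add_left (measure_union_le _ _) _)
    _ ≤ _ := add_le_add (add_le_add h1 h2) h3

/-- A sequence with many pivotals is volatile. -/
theorem HasManyPivotals.volatile {k : ℕ → ℕ} (hk : Tendsto k atTop atTop)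
    {g : ∀ n, BooleanFunction (k n)} (hg : HasManyPivotals g) : Volatile g := by
  obtain ⟨a, ha, hlim⟩ := hg
  intro M
  set c : ℝ := 1 - Real.exp (-1) with hc
  have hc0 : 0 < c := by rw [hc, sub_pos, Real.exp_lt_one_iff]; norm_num
  have haR : Tendsto (fun n => √(a n : ℝ)) atTop atTop :=
    Real.tendsto_sqrt_atTop.comp (tendsto_natCast_atTop_atTop.comp ha)
  have hkR : Tendsto (fun n => (k n : ℝ)) atTop atTop := tendsto_natCast_atTop_atTop.comp hk
  -- The number of jumps must be `o(k)` to fit into unit time, while `L a / k` must diverge; `k/√a`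
  -- achieves both.
  set L : ℕ → ℕ := fun n => ⌈(k n : ℝ) / √(a n : ℝ)⌉₊ with hL
  have hbad : Tendsto (fun n => cubeMeasure (k n) {ω | (pivotalSet (g n) ω).card ≤ a n})
      atTop (𝓝 0) := by
    have : ∀ n, cubeMeasure (k n) {ω | (pivotalSet (g n) ω).card ≤ a n} =
        1 - cubeMeasure (k n) {ω | a n < (pivotalSet (g n) ω).card} := by
      intro n
      rw [← prob_compl_eq_one_sub .of_discrete]
      congr 1
      ext ω
      change _ ≤ a n ↔ ¬ a n < _
      exact not_lt.symm
    simp only [this]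
    have h := ENNReal.Tendsto.sub (tendsto_const_nhds (x := (1 : ℝ≥0∞)) (f := atTop)) hlim
      (Or.inl ENNReal.one_ne_top)
    rwa [tsub_self] at h
  have hev : ∀ᶠ n in atTop, 0 < (k n : ℝ) ∧ 0 < √(a n : ℝ) :=
    (hkR.eventually_gt_atTop 0).and (haR.eventually_gt_atTop 0)
  have hfirst : Tendsto (fun n => (L n : ℝ≥0∞) * (k n : ℝ≥0∞)⁻¹) atTop (𝓝 0) := by
    have hreal : Tendsto (fun n => (√(a n : ℝ))⁻¹ + (k n : ℝ)⁻¹) atTop (𝓝 0) := by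
      simpa using haR.inv_tendsto_atTop.add hkR.inv_tendsto_atTop
    have h0 := ENNReal.tendsto_ofReal hreal
    rw [ENNReal.ofReal_zero] at h0
    refine tendsto_of_tendsto_of_tendsto_of_le_of_le' tendsto_const_nhds h0
      (Eventually.of_forall fun n => zero_le) ?_
    filter_upwards [hev] with n hn
    rw [← ENNReal.ofReal_natCast (L n), ← ENNReal.ofReal_natCast (k n),
      ← ENNReal.ofReal_inv_of_pos hn.1, ← ENNReal.ofReal_mul (by positivity)]
    refine ENNReal.ofReal_le_ofReal ?_
    have hlt : (L n : ℝ) ≤ k n / √(a n : ℝ) + 1 := (Nat.ceil_lt_add_one (by positivity)).le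
    calc (L n : ℝ) * (k n : ℝ)⁻¹ ≤ (k n / √(a n : ℝ) + 1) * (k n : ℝ)⁻¹ := by gcongr
      _ = _ := by
        have := hn.1.ne'
        have := hn.2.ne'
        field_simp
  have hlast : Tendsto (fun n => ENNReal.ofReal (Real.exp
      (M - c * (L n * a n / (2 * k n))))) atTop (𝓝 0) := by
    have hbot : Tendsto (fun n => (M : ℝ) - c * (√(a n : ℝ) / 2)) atTop atBot := by
      have h1 : Tendsto (fun n => c * (√(a n : ℝ) / 2)) atTop atTop :=
        (haR.atTop_div_const two_pos).const_mul_atTop hc0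
      simpa only [sub_eq_add_neg, Function.comp_def] using
        tendsto_atBot_add_const_left atTop (M : ℝ) (tendsto_neg_atTop_atBot.comp h1)
    have h0 := ENNReal.tendsto_ofReal (Real.tendsto_exp_atBot.comp hbot)
    rw [ENNReal.ofReal_zero] at h0
    refine tendsto_of_tendsto_of_tendsto_of_le_of_le' tendsto_const_nhds h0
      (Eventually.of_forall fun n => zero_le) ?_
    filter_upwards [hev] with n hn
    refine ENNReal.ofReal_le_ofReal (Real.exp_le_exp.2 (sub_le_sub_left ?_ _))
    refine mul_le_mul_of_nonneg_left ?_ hc0.le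
    have hle : (k n : ℝ) / √(a n : ℝ) ≤ L n := Nat.le_ceil _
    rw [div_le_iff₀ hn.2] at hle
    have hsq : √(a n : ℝ) * √(a n : ℝ) = a n := Real.mul_self_sqrt (Nat.cast_nonneg _)
    have hk1 := hn.1
    rw [div_le_div_iff₀ two_pos (by positivity)]
    have := mul_le_mul_of_nonneg_right hle hn.2.le
    rw [mul_assoc, hsq] at this
    nlinarith
  have hsum := (hfirst.add (ENNReal.Tendsto.const_mul (a := 2) hbad
    (Or.inr ENNReal.ofNat_ne_top))).add hlast
  simp only [mul_zero, add_zero] at hsum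
  refine tendsto_of_tendsto_of_tendsto_of_le_of_le' tendsto_const_nhds hsum
    (Eventually.of_forall fun n => zero_le) ?_
  filter_upwards [hev] with n hn
  have hk0 : k n ≠ 0 := by have := hn.1; intro h; rw [h] at this; simp at this
  have hL0 : L n ≠ 0 := (Nat.ceil_pos.2 (div_pos hn.1 hn.2)).ne'
  exact walkMeasure_changeCount_le hk0 (g n) hL0 (a n) M

/-! ### Independence of disjoint blocks of coordinates. -/

theorem cubeMeasure_eq_infinitePi (k : ℕ) :
    cubeMeasure k = Measure.infinitePi fun _ : Fin k => uniformOn (Set.univ : Set ℤˣ) := by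
  have : ∀ _ : Fin k, IsProbabilityMeasure (uniformOn (Set.univ : Set ℤˣ)) := fun _ =>
    isProbabilityMeasure_uniformOn Set.finite_univ Set.univ_nonempty
  rw [Measure.infinitePi_eq_pi, ← uniformOn_pi, Set.pi_univ, cubeMeasure]

theorem cubeMeasure_singleton {k : ℕ} (η : Cube k) :
    cubeMeasure k {η} = (2 ^ k : ℝ≥0∞)⁻¹ := by
  rw [cubeMeasure, uniformOn_univ, Measure.count_singleton, one_div]
  simp

/-- A block of coordinates is uniformly distributed. -/
theorem map_block_cubeMeasure {k w : ℕ} {e : Fin w → Fin k} (he : Function.Injective e) :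
    (cubeMeasure k).map (fun ω l => ω (e l)) = cubeMeasure w := by
  have : IsProbabilityMeasure (uniformOn (Set.univ : Set ℤˣ)) :=
    isProbabilityMeasure_uniformOn Set.finite_univ Set.univ_nonempty
  rw [cubeMeasure_eq_infinitePi, cubeMeasure_eq_infinitePi]
  exact Measure.map_infinitePi_infinitePi_of_inj he

theorem cubeMeasure_block_mem {k w : ℕ} {e : Fin w → Fin k} (he : Function.Injective e)
    (S : Set (Cube w)) : cubeMeasure k {ω | (fun l => ω (e l)) ∈ S} = cubeMeasure w S := by
  rw [← map_block_cubeMeasure he, Measure.map_apply .of_discrete .of_discrete]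
  rfl

/-- Disjoint blocks of coordinates are independent. -/
theorem iIndepFun_block {k N w : ℕ} {e : Fin N × Fin w → Fin k} (he : Function.Injective e) :
    iIndepFun (fun (j : Fin N) (ω : Cube k) (l : Fin w) => ω (e (j, l))) (cubeMeasure k) := by
  have : IsProbabilityMeasure (uniformOn (Set.univ : Set ℤˣ)) :=
    isProbabilityMeasure_uniformOn Set.finite_univ Set.univ_nonempty
  rw [iIndepFun_iff_map_fun_eq_infinitePi_map fun _ => .of_discrete]
  have h1 : ∀ j : Fin N, (cubeMeasure k).map (fun ω (l : Fin w) => ω (e (j, l))) =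
      Measure.infinitePi fun _ : Fin w => uniformOn (Set.univ : Set ℤˣ) := fun j => by
    rw [map_block_cubeMeasure (e := fun l => e (j, l))
      fun a b h => (Prod.mk.inj (he h)).2, cubeMeasure_eq_infinitePi]
  simp only [h1]
  rw [← Measure.infinitePi_map_curry
    (fun (_ : Fin N) (_ : Fin w) => uniformOn (Set.univ : Set ℤˣ)),
    ← Measure.map_infinitePi_infinitePi_of_inj (P := fun _ => uniformOn (Set.univ : Set ℤˣ)) he,
    ← cubeMeasure_eq_infinitePi, Measure.map_map (MeasurableEquiv.measurable _) .of_discrete]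
  rfl

/-! ### The tribes function and its critical blocks. -/

open Classical in
/-- The AND over the blocks `e (j, ·)` of the OR over the coordinates in the block. -/
noncomputable def tribes {k N w : ℕ} (e : Fin N × Fin w → Fin k) : BooleanFunction k :=
  fun ω => if ∃ j, ∀ l, ω (e (j, l)) = -1 then -1 else 1

theorem units_le_one (u : ℤˣ) : u ≤ 1 := by
  rcases Int.units_eq_one_or u with rfl | rfl <;> decide

theorem neg_one_le_units (u : ℤˣ) : -1 ≤ u := by
  rcases Int.units_eq_one_or u with rfl | rfl <;> decide

theorem units_eq_neg_one_of_ne {u : ℤˣ} (h : u ≠ 1) : u = -1 :=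
  (Int.units_eq_one_or u).resolve_left h

theorem tribes_eq_neg_one_iff {k N w : ℕ} (e : Fin N × Fin w → Fin k) (ω : Cube k) :
    tribes e ω = -1 ↔ ∃ j, ∀ l, ω (e (j, l)) = -1 := by
  unfold tribes
  split_ifs with h
  · simpa using h
  · simp only [h, iff_false]; decide

theorem monotone_tribes {k N w : ℕ} (e : Fin N × Fin w → Fin k) : Monotone (tribes e) := by
  intro ω η h
  by_cases hη : tribes e η = 1
  · rw [hη]; exact units_le_one _
  · obtain ⟨j, hj⟩ := (tribes_eq_neg_one_iff e η).1 (units_eq_neg_one_of_ne hη)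
    have : tribes e ω = -1 := (tribes_eq_neg_one_iff e ω).2 ⟨j, fun l =>
      le_antisymm (hj l ▸ h (e (j, l))) (neg_one_le_units _)⟩
    rw [this]
    exact neg_one_le_units _

theorem cubeMeasure_tribes_le {k N w : ℕ} {e : Fin N × Fin w → Fin k}
    (he : Function.Injective e) :
    cubeMeasure k {ω | tribes e ω = -1} ≤ N * (2 ^ w : ℝ≥0∞)⁻¹ := by
  have hj : ∀ j : Fin N, cubeMeasure k {ω | ∀ l, ω (e (j, l)) = -1} = (2 ^ w : ℝ≥0∞)⁻¹ := by
    intro j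
    rw [← cubeMeasure_singleton (fun _ => -1 : Cube w),
      ← cubeMeasure_block_mem (e := fun l => e (j, l)) fun a b h => (Prod.mk.inj (he h)).2]
    congr 1
    ext ω
    exact funext_iff.symm
  calc cubeMeasure k {ω | tribes e ω = -1}
      = cubeMeasure k (⋃ j : Fin N, {ω | ∀ l, ω (e (j, l)) = -1}) := by
        congr 1
        ext ω
        rw [Set.mem_iUnion]
        exact tribes_eq_neg_one_iff e ω
    _ ≤ ∑ j : Fin N, cubeMeasure k {ω | ∀ l, ω (e (j, l)) = -1} := measure_iUnion_fintype_le _ _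
    _ = _ := by simp [hj]

/-- The configurations of a block with exactly one coordinate equal to `1`. -/
def criticalSet (w : ℕ) : Set (Cube w) := {η | ∃! l, η l = 1}

theorem le_cubeMeasure_criticalSet (w : ℕ) :
    (w : ℝ) * (2 ^ w)⁻¹ ≤ (cubeMeasure w).real (criticalSet w) := by
  classical
  set φ : Fin w → Cube w := fun l => Function.update (fun _ => -1) l 1 with hφ
  have h1 : (-1 : ℤˣ) ≠ 1 := by decide
  have hinj : Function.Injective φ := by
    intro a b hab
    by_contra hne
    have := congrFun hab a
    simp only [hφ, Function.update_self, Function.update_of_ne hne] at this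
    exact h1 this.symm
  have hsub : ((Finset.univ.image φ : Finset (Cube w)) : Set (Cube w)) ⊆ criticalSet w := by
    intro η hη
    obtain ⟨l, -, rfl⟩ := Finset.mem_image.1 hη
    refine ⟨l, by simp [hφ], fun m hm => ?_⟩
    by_contra hne
    simp only [hφ, Function.update_of_ne hne] at hm
    exact h1 hm
  have hs : ∀ η : Cube w, (cubeMeasure w).real {η} = (2 ^ w : ℝ)⁻¹ := fun η => by
    rw [measureReal_def, cubeMeasure_singleton]
    simp
  calc (w : ℝ) * (2 ^ w)⁻¹
      = (cubeMeasure w).real ((Finset.univ.image φ : Finset (Cube w)) : Set (Cube w)) := by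
        rw [← sum_measureReal_singleton]
        simp [hs, Finset.card_image_of_injective _ hinj]
    _ ≤ _ := measureReal_mono hsub

open Classical in
/-- The blocks that are critical at `ω`. -/
noncomputable def criticalBlocks {k N w : ℕ} (e : Fin N × Fin w → Fin k) (ω : Cube k) :
    Finset (Fin N) :=
  Finset.univ.filter fun j => (fun l => ω (e (j, l))) ∈ criticalSet w

/-- Flipping the only `1` of a critical block makes the block all `-1` and drops the value from `1`
to `-1`; distinct blocks give distinct coordinates. -/
theorem card_criticalBlocks_le {k N w : ℕ} {e : Fin N × Fin w → Fin k}
    (he : Function.Injective e) {ω : Cube k} (hω : tribes e ω = 1) :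
    (criticalBlocks e ω).card ≤ (pivotalSet (tribes e) ω).card := by
  classical
  have hmem : ∀ j ∈ criticalBlocks e ω, ∃! l, ω (e (j, l)) = 1 := fun j hj =>
    (Finset.mem_filter.1 hj).2
  -- `choose!` needs a default coordinate; blocks of width `0` are never critical.
  rcases isEmpty_or_nonempty (Fin w) with hw | hw
  · have : criticalBlocks e ω = ∅ := Finset.eq_empty_of_forall_notMem fun j hj =>
      hw.elim (hmem j hj).choose
    simp [this]
  choose! l hl hl' using hmem
  refine Finset.card_le_card_of_injOn (fun j => e (j, l j)) (fun j hj => ?_) ?_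
  · refine Finset.mem_filter.2 ⟨Finset.mem_univ _, ?_⟩
    have : tribes e (flipAt ω (e (j, l j))) = -1 := by
      refine (tribes_eq_neg_one_iff e _).2 ⟨j, fun m => ?_⟩
      by_cases hm : m = l j
      · rw [hm, flipAt, Function.update_self, hl j hj]
      · have hne : e (j, m) ≠ e (j, l j) := fun h => hm (Prod.mk.inj (he h)).2
        rw [flipAt, Function.update_of_ne hne]
        exact units_eq_neg_one_of_ne fun h => hm (hl' j hj m h)
    rw [this, hω]
    decide
  · intro i _ j _ hij
    exact (Prod.mk.inj (he hij)).1

/-- A Chernoff lower-tail bound: the blocks are independent, and each is critical with probability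
at least `w / 2 ^ w`. -/
theorem cubeMeasure_criticalBlocks_le {k N w : ℕ} {e : Fin N × Fin w → Fin k}
    (he : Function.Injective e) (a : ℕ) :
    cubeMeasure k {ω | (criticalBlocks e ω).card ≤ a} ≤
      ENNReal.ofReal (Real.exp (a - (1 - Real.exp (-1)) * (N * (w * (2 ^ w)⁻¹)))) := by
  classical
  set F : Cube w → ℝ≥0∞ := fun η =>
    if η ∈ criticalSet w then ENNReal.ofReal (Real.exp (-1)) else 1 with hF
  set p : ℝ := w * (2 ^ w)⁻¹ with hp
  set c : ℝ := 1 - Real.exp (-1) with hc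
  set X : Fin N → Cube k → ℝ≥0∞ := fun j ω => F fun l => ω (e (j, l)) with hX
  have hprod : ∀ ω, ∏ j, X j ω = ENNReal.ofReal (Real.exp (-(criticalBlocks e ω).card)) := by
    intro ω
    simp only [hX, hF]
    rw [Finset.prod_ite, Finset.prod_const, Finset.prod_const_one, mul_one,
      ← ENNReal.ofReal_pow (Real.exp_pos _).le, ← Real.exp_nat_mul, mul_neg_one]
    unfold criticalBlocks
    congr!
  have hind : iIndepFun X (cubeMeasure k) :=
    (iIndepFun_block he).comp (fun _ => F) fun _ => .of_discrete
  have hE : ∀ j, ∫⁻ ω, X j ω ∂cubeMeasure k ≤ ENNReal.ofReal (Real.exp (-(c * p))) := by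
    intro j
    have hinj : Function.Injective fun l => e (j, l) := fun a b h => (Prod.mk.inj (he h)).2
    have : ∫⁻ ω, X j ω ∂cubeMeasure k = ∫⁻ η, F η ∂cubeMeasure w := by
      rw [← map_block_cubeMeasure hinj, lintegral_map .of_discrete .of_discrete]
    rw [this]
    exact lintegral_ite_exp_neg_one_le _ .of_discrete (le_cubeMeasure_criticalSet w)
  have hint : ∫⁻ ω, ∏ j, X j ω ∂cubeMeasure k ≤ ENNReal.ofReal (Real.exp (-(c * (N * p)))) := by
    rw [lintegral_prod_eq_prod_lintegral_of_indepFun Finset.univ X hind fun _ => .of_discrete]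
    refine (Finset.prod_le_prod' fun j _ => hE j).trans ?_
    rw [Finset.prod_const, Finset.card_univ, Fintype.card_fin,
      ← ENNReal.ofReal_pow (Real.exp_pos _).le, ← Real.exp_nat_mul]
    refine le_of_eq ?_
    congr 2
    ring
  have hpos : 0 < Real.exp (-(a : ℝ)) := Real.exp_pos _
  calc cubeMeasure k {ω | (criticalBlocks e ω).card ≤ a}
      ≤ cubeMeasure k {ω | ENNReal.ofReal (Real.exp (-(a : ℝ))) ≤ ∏ j, X j ω} := by
        refine measure_mono fun ω hω => ?_
        change ENNReal.ofReal (Real.exp (-(a : ℝ))) ≤ ∏ j, X j ω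
        rw [hprod]
        refine ENNReal.ofReal_le_ofReal (Real.exp_le_exp.2 (neg_le_neg ?_))
        exact_mod_cast hω
    _ ≤ (∫⁻ ω, ∏ j, X j ω ∂cubeMeasure k) / ENNReal.ofReal (Real.exp (-(a : ℝ))) :=
        meas_ge_le_lintegral_div Measurable.of_discrete.aemeasurable
          (ENNReal.ofReal_pos.2 hpos).ne' ENNReal.ofReal_ne_top
    _ ≤ ENNReal.ofReal (Real.exp (-(c * (N * p)))) / ENNReal.ofReal (Real.exp (-(a : ℝ))) :=
        ENNReal.div_le_div_right hint _
    _ = _ := by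
        rw [← ENNReal.ofReal_div_of_pos hpos, ← Real.exp_sub]
        congr 2
        ring

/-- A monotone function that is almost constant and nevertheless has many pivotals. -/
theorem exists_monotone_few_neg_one_many_pivotals {k v : ℕ} (h : 2 ^ (4 ^ v + v) ≤ k) :
    ∃ C : BooleanFunction k, Monotone C ∧
      cubeMeasure k {ω | C ω = -1} ≤ ENNReal.ofReal ((2 ^ v)⁻¹) ∧
      ∀ a : ℕ, cubeMeasure k {ω | (pivotalSet C ω).card ≤ a} ≤
        ENNReal.ofReal ((2 ^ v)⁻¹) +
          ENNReal.ofReal (Real.exp (a - (1 - Real.exp (-1)) * 2 ^ v)) := by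
  have hv : v ≤ 4 ^ v := (Nat.lt_pow_self (by norm_num)).le
  -- Width `w = 4 ^ v` and `N = 2 ^ (w - v)` blocks: `N / 2 ^ w = 2 ^ (-v)` bounds the chance of the
  -- value `-1`, while `N w / 2 ^ w = 2 ^ v` critical blocks are expected.
  have hN : 2 ^ (4 ^ v - v) * 4 ^ v ≤ k := by
    refine le_trans (le_of_eq ?_) h
    rw [show (4 : ℕ) ^ v = 2 ^ v * 2 ^ v by rw [← mul_pow]; rfl, ← mul_assoc, ← pow_add, ← pow_add]
    congr 1
    rw [show (2 : ℕ) ^ v * 2 ^ v = 4 ^ v by rw [← mul_pow]; rfl]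
    omega
  set e : Fin (2 ^ (4 ^ v - v)) × Fin (4 ^ v) → Fin k :=
    fun p => Fin.castLE hN (finProdFinEquiv p)
  have he : Function.Injective e :=
    (Fin.castLE_injective hN).comp finProdFinEquiv.injective
  have hratio : (2 : ℝ) ^ (4 ^ v - v) * (2 ^ 4 ^ v)⁻¹ = (2 ^ v)⁻¹ := by
    rw [← div_eq_mul_inv, div_eq_iff (by positivity), eq_comm, inv_mul_eq_div,
      div_eq_iff (by positivity), ← pow_add]
    congr 1
    omega
  have hneg : cubeMeasure k {ω | tribes e ω = -1} ≤ ENNReal.ofReal ((2 ^ v)⁻¹) := by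
    refine (cubeMeasure_tribes_le he).trans (le_of_eq ?_)
    rw [← hratio, ENNReal.ofReal_mul (by positivity), ENNReal.ofReal_inv_of_pos (by positivity),
      ENNReal.ofReal_pow zero_le_two, ENNReal.ofReal_pow zero_le_two]
    simp
  refine ⟨tribes e, monotone_tribes e, hneg, fun a => ?_⟩
  have hcrit := cubeMeasure_criticalBlocks_le he a
  have hmean : (((2 ^ (4 ^ v - v) : ℕ) : ℝ) * (((4 ^ v : ℕ) : ℝ) * (2 ^ 4 ^ v)⁻¹)) = 2 ^ v := by
    push_cast
    rw [mul_left_comm, hratio, show (4 : ℝ) ^ v = 2 ^ v * 2 ^ v by rw [← mul_pow]; norm_num,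
      mul_inv_cancel_right₀ (by positivity)]
  rw [hmean] at hcrit
  refine le_trans ?_ (add_le_add hneg hcrit)
  refine le_trans (measure_mono fun ω hω => ?_) (measure_union_le _ _)
  by_cases h1 : tribes e ω = 1
  · exact Or.inr ((card_criticalBlocks_le he h1).trans hω)
  · exact Or.inl (units_eq_neg_one_of_ne h1)

/-- There are monotone functions that are almost constantly `1` and have many pivotals. -/
theorem exists_monotone_sequence_many_pivotals {k : ℕ → ℕ} (hk : Tendsto k atTop atTop) :
    ∃ (C : ∀ n, BooleanFunction (k n)) (a : ℕ → ℕ), (∀ n, Monotone (C n)) ∧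
      Tendsto a atTop atTop ∧
      Tendsto (fun n => cubeMeasure (k n) {ω | C n ω = -1}) atTop (𝓝 0) ∧
      Tendsto (fun n => cubeMeasure (k n) {ω | (pivotalSet (C n) ω).card ≤ a n})
        atTop (𝓝 0) := by
  set v : ℕ → ℕ := fun n => Nat.findGreatest (fun v => 2 ^ (4 ^ v + v) ≤ k n) (k n) with hv
  have hvlim : Tendsto v atTop atTop := by
    refine tendsto_atTop.2 fun b => ?_
    filter_upwards [hk.eventually_ge_atTop (2 ^ (4 ^ b + b))] with n hn
    refine Nat.le_findGreatest ?_ hn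
    exact ((Nat.le_add_left b _).trans Nat.lt_two_pow_self.le).trans hn
  -- For `v = 0` the condition reads `2 ≤ k n`; below that the search returns `0` without satisfying
  -- it.
  have hspec : ∀ᶠ n in atTop, 2 ^ (4 ^ v n + v n) ≤ k n := by
    filter_upwards [hk.eventually_ge_atTop 2] with n hn
    exact Nat.findGreatest_spec (P := fun v => 2 ^ (4 ^ v + v) ≤ k n) (Nat.zero_le _)
      (by simpa using hn)
  have hex : ∀ n, ∃ C : BooleanFunction (k n), Monotone C ∧ (2 ^ (4 ^ v n + v n) ≤ k n →
      cubeMeasure (k n) {ω | C ω = -1} ≤ ENNReal.ofReal ((2 ^ v n)⁻¹) ∧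
      ∀ a : ℕ, cubeMeasure (k n) {ω | (pivotalSet C ω).card ≤ a} ≤
        ENNReal.ofReal ((2 ^ v n)⁻¹) +
          ENNReal.ofReal (Real.exp (a - (1 - Real.exp (-1)) * 2 ^ v n))) := by
    intro n
    by_cases h : 2 ^ (4 ^ v n + v n) ≤ k n
    · obtain ⟨C, hC, h'⟩ := exists_monotone_few_neg_one_many_pivotals h
      exact ⟨C, hC, fun _ => h'⟩
    · exact ⟨fun _ => 1, monotone_const, fun h' => absurd h' h⟩
  choose C hC hbound using hex
  have hpow : Tendsto (fun n => (2 : ℝ) ^ v n) atTop atTop :=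
    (tendsto_pow_atTop_atTop_of_one_lt one_lt_two).comp hvlim
  have hinv : Tendsto (fun n => ENNReal.ofReal ((2 ^ v n)⁻¹)) atTop (𝓝 0) := by
    simpa only [ENNReal.ofReal_zero, Pi.inv_apply] using ENNReal.tendsto_ofReal hpow.inv_tendsto_atTop
  have hexp : Tendsto (fun n => ENNReal.ofReal (Real.exp (-(2 ^ v n / 4)))) atTop (𝓝 0) := by
    have h := Real.tendsto_exp_neg_atTop_nhds_zero.comp
      (hpow.atTop_div_const (r := 4) (by norm_num))
    simpa only [ENNReal.ofReal_zero, Function.comp_apply] using ENNReal.tendsto_ofReal h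
  -- Since `1 - 1/e > 1/2`, the threshold `2 ^ v / 4` leaves an exponent of at most `-2 ^ v / 4`.
  refine ⟨C, fun n => ⌊(2 : ℝ) ^ v n / 4⌋₊, hC,
    tendsto_nat_floor_atTop.comp (hpow.atTop_div_const (by norm_num)), ?_, ?_⟩
  · refine tendsto_of_tendsto_of_tendsto_of_le_of_le' tendsto_const_nhds hinv
      (Eventually.of_forall fun n => zero_le) ?_
    filter_upwards [hspec] with n hn using (hbound n hn).1
  · have hsum := hinv.add hexp
    rw [add_zero] at hsum
    refine tendsto_of_tendsto_of_tendsto_of_le_of_le' tendsto_const_nhds hsum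
      (Eventually.of_forall fun n => zero_le) ?_
    filter_upwards [hspec] with n hn
    refine ((hbound n hn).2 _).trans (add_le_add_right ?_ _)
    refine ENNReal.ofReal_le_ofReal (Real.exp_le_exp.2 ?_)
    have h1 : (⌊(2 : ℝ) ^ v n / 4⌋₊ : ℝ) ≤ 2 ^ v n / 4 := Nat.floor_le (by positivity)
    have h2 : Real.exp (-1) < 1 / 2 := Real.exp_neg_one_lt_d9.trans (by norm_num)
    have h3 : (0 : ℝ) < 2 ^ v n := by positivity
    nlinarith

/-! ### Duality and the perturbation of `f`. -/

/-- The dual of a Boolean function. -/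
def dualFunction {k : ℕ} (C : BooleanFunction k) : BooleanFunction k := fun ω => -C (-ω)

theorem units_neg_le_neg {a b : ℤˣ} (h : a ≤ b) : -b ≤ -a := by
  revert a b; decide

theorem Monotone.dualFunction {k : ℕ} {C : BooleanFunction k} (hC : Monotone C) :
    Monotone (dualFunction C) := fun _ _ h =>
  units_neg_le_neg (hC fun i => units_neg_le_neg (h i))

theorem flipAt_neg {k : ℕ} (ω : Cube k) (i : Fin k) : flipAt (-ω) i = -flipAt ω i := by
  funext j
  by_cases hj : j = i
  · subst hj; simp [flipAt]
  · simp [flipAt, Function.update_of_ne hj]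

theorem pivotalSet_dualFunction {k : ℕ} (C : BooleanFunction k) (ω : Cube k) :
    pivotalSet (dualFunction C) ω = pivotalSet C (-ω) := by
  simp only [pivotalSet, dualFunction, flipAt_neg, ne_eq, neg_inj]

theorem flipAt_le_or_le {k : ℕ} (ω : Cube k) (i : Fin k) : flipAt ω i ≤ ω ∨ ω ≤ flipAt ω i := by
  rcases Int.units_eq_one_or (ω i) with h | h
  · exact Or.inl (update_le_self_iff.2 (units_le_one _ |>.trans h.ge))
  · exact Or.inr (le_update_self_iff.2 (h.le.trans (neg_one_le_units _)))

/-- `f`, lowered where `C = -1` and then raised where `D = 1`. -/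
def perturb {k : ℕ} (f C D : BooleanFunction k) : BooleanFunction k := f ⊓ C ⊔ D

theorem perturb_eq {k : ℕ} {f C D : BooleanFunction k} {ω : Cube k} (hC : C ω = 1)
    (hD : D ω = -1) : perturb f C D ω = f ω := by
  simp only [perturb, Pi.sup_apply, Pi.inf_apply, hC, hD, inf_eq_left.2 (units_le_one _),
    sup_eq_left.2 (neg_one_le_units _)]

/-- A flip that lowers the monotone `C` must go down in the order, so it cannot raise `D`; the
perturbed value becomes `-1`. -/
theorem pivotalSet_subset_perturb_of_one {k : ℕ} {f C D : BooleanFunction k} (hCm : Monotone C)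
    (hDm : Monotone D) {ω : Cube k} (hC : C ω = 1) (hD : D ω = -1) (hf : f ω = 1) :
    pivotalSet C ω ⊆ pivotalSet (perturb f C D) ω := by
  intro i hi
  have hi' : C (flipAt ω i) = -1 := units_eq_neg_one_of_ne (hC ▸ (Finset.mem_filter.1 hi).2)
  have hle : flipAt ω i ≤ ω := (flipAt_le_or_le ω i).resolve_right fun h => by
    have := hCm h
    rw [hC, hi'] at this
    exact absurd this (by decide)
  have hD' : D (flipAt ω i) = -1 := le_antisymm (hD ▸ hDm hle) (neg_one_le_units _)
  refine Finset.mem_filter.2 ⟨Finset.mem_univ _, ?_⟩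
  rw [perturb_eq hC hD, hf]
  simp only [perturb, Pi.sup_apply, Pi.inf_apply, hi', hD', inf_eq_right.2 (neg_one_le_units _),
    sup_idem]
  decide

/-- Once `D` turns to `1`, the outer join forces the value `1`, whatever `f` and `C` do at the
flipped point. -/
theorem pivotalSet_subset_perturb_of_neg_one {k : ℕ} {f C D : BooleanFunction k} {ω : Cube k}
    (hC : C ω = 1) (hD : D ω = -1) (hf : f ω = -1) :
    pivotalSet D ω ⊆ pivotalSet (perturb f C D) ω := by
  intro i hi
  have hi' : D (flipAt ω i) = 1 := by
    by_contra h
    exact (Finset.mem_filter.1 hi).2 ((units_eq_neg_one_of_ne h).trans hD.symm)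
  refine Finset.mem_filter.2 ⟨Finset.mem_univ _, ?_⟩
  rw [perturb_eq hC hD, hf]
  simp only [perturb, Pi.sup_apply, Pi.inf_apply, hi', sup_eq_right.2 (units_le_one _)]
  decide

theorem exists_close_many_pivotals {k : ℕ → ℕ} (hk : Tendsto k atTop atTop)
    (f : ∀ n, BooleanFunction (k n)) :
    ∃ g : ∀ n, BooleanFunction (k n), AsymptoticallyClose f g ∧ HasManyPivotals g ∧
      ∀ n, Monotone (f n) → Monotone (g n) := by
  obtain ⟨C, a, hCm, ha, hneg, hpiv⟩ := exists_monotone_sequence_many_pivotals hk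
  have hneginj : ∀ m, Function.Injective fun ω : Cube m => -ω := fun m => neg_injective
  have hnegD : ∀ n, cubeMeasure (k n) {ω | dualFunction (C n) ω = 1} =
      cubeMeasure (k n) {ω | C n ω = -1} := fun n => by
    rw [← cubeMeasure_preimage (hneginj (k n)) {ω | C n ω = -1}]
    congr 1
    ext ω
    exact neg_eq_iff_eq_neg
  have hpivD : ∀ n, cubeMeasure (k n) {ω | (pivotalSet (dualFunction (C n)) ω).card ≤ a n} =
      cubeMeasure (k n) {ω | (pivotalSet (C n) ω).card ≤ a n} := fun n => by
    rw [← cubeMeasure_preimage (hneginj (k n)) {ω | (pivotalSet (C n) ω).card ≤ a n}]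
    congr 1
    ext ω
    change _ ≤ a n ↔ _ ≤ a n
    rw [pivotalSet_dualFunction]
  set g : ∀ n, BooleanFunction (k n) := fun n => perturb (f n) (C n) (dualFunction (C n)) with hg
  refine ⟨g, ?_, ⟨a, ha, ?_⟩, fun n hf => ?_⟩
  · have hsum := hneg.add hneg
    rw [add_zero] at hsum
    refine tendsto_of_tendsto_of_tendsto_of_le_of_le tendsto_const_nhds hsum
      (fun n => zero_le) fun n => ?_
    nth_rw 2 [← hnegD n]
    refine le_trans (measure_mono fun ω hω => ?_) (measure_union_le _ _)
    by_cases hC : C n ω = 1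
    · refine Or.inr (by_contra fun hD => hω ?_)
      exact (perturb_eq hC (units_eq_neg_one_of_ne hD)).symm
    · exact Or.inl (units_eq_neg_one_of_ne hC)
  · have hbad : Tendsto (fun n => cubeMeasure (k n) {ω | (pivotalSet (g n) ω).card ≤ a n})
        atTop (𝓝 0) := by
      have hsum := (hneg.add hneg).add (hpiv.add hpiv)
      simp only [add_zero] at hsum
      refine tendsto_of_tendsto_of_tendsto_of_le_of_le tendsto_const_nhds hsum
        (fun n => zero_le) fun n => ?_
      -- The bound counts each probability for `C` twice; the second copy is read as the one for the
      -- dual.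
      nth_rw 2 [← hnegD n]
      nth_rw 2 [← hpivD n]
      refine le_trans (measure_mono fun ω hω => ?_) ((measure_union_le _ _).trans
        (add_le_add (measure_union_le _ _) (measure_union_le _ _)))
      change (pivotalSet (g n) ω).card ≤ a n at hω
      by_cases hC : C n ω = 1
      · by_cases hD : dualFunction (C n) ω = 1
        · exact Or.inl (Or.inr hD)
        · have hD' := units_eq_neg_one_of_ne hD
          by_cases hf : f n ω = 1
          · exact Or.inr (Or.inl ((Finset.card_le_card (pivotalSet_subset_perturb_of_one (hCm n)
              (hCm n).dualFunction hC hD' hf)).trans hω))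
          · exact Or.inr (Or.inr ((Finset.card_le_card (pivotalSet_subset_perturb_of_neg_one
              hC hD' (units_eq_neg_one_of_ne hf))).trans hω))
      · exact Or.inl (Or.inl (units_eq_neg_one_of_ne hC))
    have hcompl : ∀ n, cubeMeasure (k n) {ω | a n < (pivotalSet (g n) ω).card} =
        1 - cubeMeasure (k n) {ω | (pivotalSet (g n) ω).card ≤ a n} := fun n => by
      rw [← prob_compl_eq_one_sub .of_discrete]
      congr 1
      ext ω
      change a n < _ ↔ ¬ _ ≤ a n
      exact not_le.symm
    simp only [hcompl]
    have h := ENNReal.Tendsto.sub (tendsto_const_nhds (x := (1 : ℝ≥0∞)) (f := atTop)) hbad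
      (Or.inl ENNReal.one_ne_top)
    rwa [tsub_zero] at h
  · exact (hf.inf (hCm n)).sup (hCm n).dualFunction

theorem mainTheorem5 (k : ℕ → ℕ) (hk : Tendsto k atTop atTop)
    (f : ∀ n, BooleanFunction (k n)) :
    (∃ g : ∀ n, BooleanFunction (k n),
      AsymptoticallyClose f g ∧ Volatile g ∧ HasManyPivotals g) ∧
    ((∀ n, Monotone (f n)) →
      ∃ g : ∀ n, BooleanFunction (k n), (∀ n, Monotone (g n)) ∧
        AsymptoticallyClose f g ∧ Volatile g ∧ HasManyPivotals g) := by
  obtain ⟨g, hclose, hpiv, hmono⟩ := exists_close_many_pivotals hk f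
  exact ⟨⟨g, hclose, hpiv.volatile hk, hpiv⟩,
    fun hf => ⟨g, fun n => hmono n (hf n), hclose, hpiv.volatile hk, hpiv⟩⟩
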